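/- For a positive integer $n$, let $\|n\|$ be its integer complexity: the least number of $1$'s needed to write $n$ as an expression built from $1$'s by addition and multiplication (with arbitrary parentheses). Let $\delta(n)=\|n\|-3\log_3 n$ be the defect of $n$, and call $n$ stable if $\|3^k n\|=3k+\|n\|$ for every integer $k\ge 0$. For a congruence class $u$ modulo $3$, let \[\mathscr{D}^u=\{\delta(n): n>1,\ \|n\|\equiv u \pmod 3\},\qquad \mathscr{D}_{\mathrm{st}}=\{\delta(n): n \text{ stable}\},\qquad \mathscr{D}^u_{\mathrm{st}}=\mathscr{D}^u\cap\mathscr{D}_{\mathrm{st}}.\] Then for every congruence class $u$ modulo $3$, with closures taken in $\mathbb{R}$, \[\overline{\mathscr{D}^u_{\mathrm{st}}}=(\mathscr{D}^u_{\mathrm{st}}+3\mathbb{Z}_{\ge0})\cup(\mathscr{D}^{u-1}_{\mathrm{st}}+3\mathbb{Z}_{\ge0}+1)\cup(\mathscr{D}^{u-2}_{\mathrm{st}}+3\mathbb{Z}_{\ge0}+2).\] Equivalently, \[\overline{\mathscr{D}^u_{\mathrm{st}}}=\{k-3\log_3 n : n\ge 1,\ k\ge\|n\|,\ k\equiv u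 \pmod 3\},\] where $k$ and $n$ range over integers. Moreover, each $\mathscr{D}^u_{\mathrm{st}}$ is a discrete subset of $\mathbb{R}$, i.e. it contains none of its own limit points. -/

import Mathlib

open scoped Pointwise

namespace IntegerComplexity

/-- Formal expressions built from the number `1` by addition and multiplication. -/
inductive OneExpr : Type
  | one : OneExpr
  | add : OneExpr → OneExpr → OneExpr
  | mul : OneExpr → OneExpr → OneExpr

/-- The number that an expression evaluates to. -/
def OneExpr.val : OneExpr → ℕ
  | .one => 1
  | .add a b => a.val + b.val
  | .mul a b => a.val * b.val

/-- The number of ones used in an expression. -/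
def OneExpr.ones : OneExpr → ℕ
  | .one => 1
  | .add a b => a.ones + b.ones
  | .mul a b => a.ones + b.ones

/-- The complexity `‖n‖` of a positive integer `n`: the least number of ones in an expression
for `n`. (Only used for `0 < n`.) -/
noncomputable def complexity (n : ℕ) : ℕ :=
  sInf {c : ℕ | ∃ E : OneExpr, E.val = n ∧ E.ones = c}

/-- For `0 < n` the infimum defining the complexity is attained. -/
theorem exists_oneExpr_complexity {n : ℕ} (hn : 0 < n) :
    ∃ E : OneExpr, E.val = n ∧ E.ones = complexity n := by
  have h : ∃ E : OneExpr, E.val = n := by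
    induction n, hn using Nat.le_induction with
    | base => exact ⟨.one, rfl⟩
    | succ m _ ih =>
      obtain ⟨E, hE⟩ := ih
      exact ⟨.add E .one, by simp [OneExpr.val, hE]⟩
  obtain ⟨E, hE⟩ := h
  exact Nat.sInf_mem (s := {c : ℕ | ∃ E : OneExpr, E.val = n ∧ E.ones = c}) ⟨_, E, hE, rfl⟩

/-- The defect `δ(n) = ‖n‖ - 3 log₃ n`. -/
noncomputable def defect (n : ℕ) : ℝ :=
  (complexity n : ℝ) - 3 * Real.logb 3 (n : ℝ)

/-- A positive integer `n` is stable if `‖3 ^ k n‖ = 3 k + ‖n‖` for all `k ≥ 0`. -/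
def IsStable (n : ℕ) : Prop :=
  0 < n ∧ ∀ k : ℕ, complexity (3 ^ k * n) = 3 * k + complexity n

/-- The set `𝒟ᵘ` of defects of numbers `n > 1` with `‖n‖ ≡ u (mod 3)`. -/
def defectSetMod (u : ZMod 3) : Set ℝ :=
  {x : ℝ | ∃ n : ℕ, 1 < n ∧ (complexity n : ZMod 3) = u ∧ defect n = x}

/-- The set `𝒟_st` of stable defects, i.e. of defects of stable numbers. -/
def stableDefectSet : Set ℝ :=
  {x : ℝ | ∃ n : ℕ, IsStable n ∧ defect n = x}

/-- The set `𝒟ᵘ_st = 𝒟ᵘ ∩ 𝒟_st`. -/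
def stableDefectSetMod (u : ZMod 3) : Set ℝ :=
  defectSetMod u ∩ stableDefectSet

/-- The set `3 ℤ_{≥ 0}` of nonnegative integer multiples of three, as real numbers. -/
def threeMultiples : Set ℝ :=
  Set.range (fun m : ℕ => 3 * (m : ℝ))

end IntegerComplexity

namespace IntegerComplexity

open Filter Topology

/-! ### Elementary properties of the complexity -/

/-! Let U be the set of values k - 3 log₃ n with k ≥ ‖n‖ and k ≡ u (`upperDefectSetMod`).
Multiplying n by a power of 3 until it is stable shows that U consists of the numbers δ(n) + j with
n stable and ‖n‖ ≡ u - j; sorting by j mod 3 gives the threefold union.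

The closure lies in U because numbers of bounded defect are rigid (`exists_hasLimit_of_defect_le`).
Along an ultrafilter they are exactly 3^e m with cost 3e + c and c ≥ ‖m‖, or asymptotic to 3^e m
with e → ∞ and c ≥ ‖m‖ + 1. This is an induction on the defect in steps of 1/10: by `decomposition`,
an optimal expression that is not one of the base shapes 3^e·3 and 3^e·2 is a product of two numbers
of smaller defect, or a power of 3 times a sum a + b with a of smaller defect and b bounded. Defects
then converge to c - 3 log₃ m.

Conversely, if m is stable then 3^a m + 1 is stable of complexity 3a + ‖m‖ + 1 for large a
(`IsStable.eventually_isStable`), so δ(m) + 1 is a limit of stable defects; iterating reaches δ(m) +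
j. A cheaper way to write infinitely many of the numbers 3^t (3^a m + 1) would contradict the
rigidity.

Discreteness comes from the extra 1 in the asymptotic case: a limit that is not eventually attained
has c > ‖m‖, which a stable defect cannot have. -/

theorem OneExpr.val_pos (E : OneExpr) : 0 < E.val := by
  induction E with
  | one => simp [val]
  | add a b iha ihb => simp only [val]; omega
  | mul a b iha ihb => simp only [val]; positivity

theorem OneExpr.complexity_val_le (E : OneExpr) : complexity E.val ≤ E.ones :=
  Nat.sInf_le ⟨E, rfl, rfl⟩

theorem OneExpr.one_le_ones (E : OneExpr) : 1 ≤ E.ones := by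
  induction E with
  | one => simp [ones]
  | add a b iha ihb => simp only [ones]; omega
  | mul a b iha ihb => simp only [ones]; omega

theorem complexity_one_le : complexity 1 ≤ 1 := OneExpr.complexity_val_le .one

theorem complexity_pos {n : ℕ} (hn : 0 < n) : 1 ≤ complexity n := by
  obtain ⟨E, -, h⟩ := exists_oneExpr_complexity hn
  exact h ▸ E.one_le_ones

theorem complexity_add_le {a b : ℕ} (ha : 0 < a) (hb : 0 < b) :
    complexity (a + b) ≤ complexity a + complexity b := by
  obtain ⟨E, rfl, hE⟩ := exists_oneExpr_complexity ha
  obtain ⟨F, rfl, hF⟩ := exists_oneExpr_complexity hb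
  rw [← hE, ← hF]
  exact OneExpr.complexity_val_le (.add E F)

theorem complexity_mul_le {a b : ℕ} (ha : 0 < a) (hb : 0 < b) :
    complexity (a * b) ≤ complexity a + complexity b := by
  obtain ⟨E, rfl, hE⟩ := exists_oneExpr_complexity ha
  obtain ⟨F, rfl, hF⟩ := exists_oneExpr_complexity hb
  rw [← hE, ← hF]
  exact OneExpr.complexity_val_le (.mul E F)

theorem complexity_two_le : complexity 2 ≤ 2 :=
  OneExpr.complexity_val_le (.add .one .one)

theorem complexity_three_le : complexity 3 ≤ 3 :=
  OneExpr.complexity_val_le (.add (.add .one .one) .one)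

theorem complexity_three_pow_mul_le {n : ℕ} (hn : 0 < n) (k : ℕ) :
    complexity (3 ^ k * n) ≤ 3 * k + complexity n := by
  induction k with
  | zero => simp
  | succ k ih =>
    have h := complexity_mul_le (a := 3) (b := 3 ^ k * n) (by norm_num) (by positivity)
    rw [show 3 ^ (k + 1) * n = 3 * (3 ^ k * n) by ring]
    have := complexity_three_le
    omega

/-- The case of a summand 1, where a + b ≤ a b fails. For a ≥ 3 it follows from (4/3)^3 < 3; for a ≤
2 from a ≤ p and (a + 1)^3 ≤ 3^(a + 1). -/
theorem add_one_pow_three_le {a p q : ℕ} (ha : 0 < a) (hp : 1 ≤ p) (hq : 1 ≤ q)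
    (h : a ^ 3 ≤ 3 ^ p) : (a + 1) ^ 3 ≤ 3 ^ (p + q) := by
  have hpq : (3 : ℕ) ^ (p + 1) ≤ 3 ^ (p + q) := Nat.pow_le_pow_right (by norm_num) (by omega)
  refine le_trans ?_ hpq
  rcases Nat.lt_or_ge a 3 with h3 | h3
  · have hap : a ≤ p := by
      by_contra! hlt
      have : p = 1 := by omega
      have : a = 2 := by omega
      subst a p
      norm_num at h
    have : (3 : ℕ) ^ (a + 1) ≤ 3 ^ (p + 1) := Nat.pow_le_pow_right (by norm_num) (by omega)
    refine le_trans ?_ this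
    interval_cases a <;> norm_num
  · rw [pow_succ 3 p]
    nlinarith [mul_le_mul h3 h3 (by norm_num) (by omega)]

theorem OneExpr.val_pow_three_le (E : OneExpr) : E.val ^ 3 ≤ 3 ^ E.ones := by
  induction E with
  | one => simp [val, ones]
  | mul a b iha ihb =>
    simp only [val, ones, mul_pow, pow_add]
    exact Nat.mul_le_mul iha ihb
  | add a b iha ihb =>
    simp only [val, ones]
    have ha := a.val_pos
    have hb := b.val_pos
    have ha' := a.one_le_ones
    have hb' := b.one_le_ones
    rcases Nat.lt_or_ge b.val 2 with h | h
    · rw [show b.val = 1 by omega]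
      exact add_one_pow_three_le ha ha' hb' iha
    rcases Nat.lt_or_ge a.val 2 with h' | h'
    · rw [show a.val = 1 by omega, add_comm 1, add_comm a.ones]
      exact add_one_pow_three_le hb hb' ha' ihb
    · calc (a.val + b.val) ^ 3 ≤ (a.val * b.val) ^ 3 := Nat.pow_le_pow_left (by nlinarith) 3
        _ = a.val ^ 3 * b.val ^ 3 := mul_pow _ _ _
        _ ≤ 3 ^ a.ones * 3 ^ b.ones := Nat.mul_le_mul iha ihb
        _ = _ := (pow_add _ _ _).symm

theorem pow_three_le_three_pow_complexity {n : ℕ} (hn : 0 < n) : n ^ 3 ≤ 3 ^ complexity n := by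
  obtain ⟨E, rfl, hE⟩ := exists_oneExpr_complexity hn
  exact hE ▸ E.val_pow_three_le

theorem three_mul_le_complexity {n : ℕ} (hn : 0 < n) (k : ℕ) :
    3 * k ≤ complexity (3 ^ k * n) := by
  have h := pow_three_le_three_pow_complexity (n := 3 ^ k * n) (by positivity)
  have h' : 3 ^ (3 * k) ≤ 3 ^ complexity (3 ^ k * n) := by
    refine le_trans ?_ h
    rw [mul_comm 3 k, pow_mul]
    exact Nat.pow_le_pow_left (Nat.le_mul_of_pos_right _ hn) 3
  exact (Nat.pow_le_pow_iff_right (by norm_num)).1 h'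

theorem IsStable.of_le {n : ℕ} (hn : 0 < n)
    (h : ∀ k, 3 * k + complexity n ≤ complexity (3 ^ k * n)) : IsStable n :=
  ⟨hn, fun k => le_antisymm (complexity_three_pow_mul_le hn k) (h k)⟩

theorem IsStable.one_lt {n : ℕ} (h : IsStable n) : 1 < n := by
  by_contra! hn
  obtain rfl : n = 1 := by have := h.1; omega
  have h1 := h.2 1
  have := complexity_three_le
  have := complexity_pos one_pos
  norm_num at h1
  omega

/-- Every positive integer becomes stable after multiplication by a power of three. -/
theorem exists_isStable_three_pow_mul {n : ℕ} (hn : 0 < n) : ∃ K, IsStable (3 ^ K * n) := by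
  let f : ℕ → ℕ := fun K => complexity (3 ^ K * n) - 3 * K
  obtain ⟨K, hK⟩ : ∃ K, ∀ j, f K ≤ f j :=
    ⟨Function.argmin f, fun j => Function.argmin_le f j⟩
  refine ⟨K, .of_le (by positivity) fun k => ?_⟩
  -- `K` minimizes the complexity of 3^K n minus 3K; `three_mul_le_complexity` ensures that the
  -- natural subtraction does not truncate.
  have h := hK (K + k)
  have h1 := three_mul_le_complexity hn K
  have h2 := three_mul_le_complexity hn (K + k)
  simp only [f] at h
  rw [show 3 ^ k * (3 ^ K * n) = 3 ^ (K + k) * n by ring]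
  omega

/-! ### Defects -/

theorem logb_three_mul {a b : ℕ} (ha : 0 < a) (hb : 0 < b) :
    Real.logb 3 ((a * b : ℕ) : ℝ) = Real.logb 3 a + Real.logb 3 b := by
  rw [Nat.cast_mul, Real.logb_mul (by positivity) (by positivity)]

theorem logb_three_pow_mul {n : ℕ} (hn : 0 < n) (k : ℕ) :
    Real.logb 3 ((3 ^ k * n : ℕ) : ℝ) = k + Real.logb 3 n := by
  rw [logb_three_mul (by positivity) hn]
  congr 1
  push_cast
  rw [Real.logb_pow, Real.logb_self_eq_one (by norm_num), mul_one]

theorem defect_nonneg {n : ℕ} (hn : 0 < n) : 0 ≤ defect n := by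
  have h : ((n : ℝ)) ^ 3 ≤ 3 ^ complexity n := by
    exact_mod_cast pow_three_le_three_pow_complexity hn
  have h' := Real.logb_le_logb_of_le (b := 3) (by norm_num) (by positivity) h
  rw [Real.logb_pow, Real.logb_pow, Real.logb_self_eq_one (by norm_num)] at h'
  push_cast at h'
  unfold defect
  linarith

theorem defect_mul_eq {u v : ℕ} (hu : 0 < u) (hv : 0 < v)
    (h : complexity (u * v) = complexity u + complexity v) :
    defect (u * v) = defect u + defect v := by
  unfold defect
  rw [h, logb_three_mul hu hv]
  push_cast
  ring

/-- Reduces numerical bounds on logarithms to comparisons of powers, such as 2^30 ≤ 3^19. -/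
theorem three_mul_logb_le {x : ℝ} (hx : 0 < x) {p q : ℕ} (hq : 0 < q) (h : x ^ (3 * q) ≤ 3 ^ p) :
    3 * Real.logb 3 x ≤ p / q := by
  have h' := Real.logb_le_logb_of_le (b := 3) (by norm_num) (by positivity) h
  rw [Real.logb_pow, Real.logb_pow, Real.logb_self_eq_one (by norm_num)] at h'
  push_cast at h'
  rw [le_div_iff₀ (by positivity)]
  linarith

theorem defect_add_eq {a b : ℕ} (ha : 0 < a)
    (h : complexity (a + b) = complexity a + complexity b) :
    defect (a + b) = defect a + (complexity b - 3 * Real.logb 3 (1 + b / a)) := by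
  have : ((a + b : ℕ) : ℝ) = a * (1 + b / a) := by
    push_cast; field_simp
  unfold defect
  rw [h, this, Real.logb_mul (by positivity) (by positivity)]
  push_cast
  ring

/-- Since a + b ≤ 2a, the logarithmic term gains at most 3 log₃ 2 ≤ 19/10, so the cost of b has to
show up in the defect. Bounded defect thus leaves finitely many choices of b. -/
theorem complexity_le_defect_add {a b : ℕ} (ha : 0 < a) (hba : b ≤ a)
    (h : complexity (a + b) = complexity a + complexity b) :
    (complexity b : ℝ) ≤ defect (a + b) + 2 := by
  have h1 := defect_add_eq ha h
  have h2 := defect_nonneg ha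
  have h3 : 3 * Real.logb 3 (1 + b / a : ℝ) ≤ ((19 : ℕ) : ℝ) / ((10 : ℕ) : ℝ) := by
    refine three_mul_logb_le (by positivity) (by norm_num) ?_
    have : (b / a : ℝ) ≤ 1 := div_le_one_of_le₀ (by exact_mod_cast hba) (by positivity)
    exact (pow_le_pow_left₀ (by positivity) (show (1 + b / a : ℝ) ≤ 2 by linarith) _).trans
      (by norm_num)
  norm_num at h3
  linarith

/-- If b = 1 then a ≥ 3 and the gain is at least 1 - 3 log₃ (4/3); if b ≥ 2 it is at least 2 - 3
log₃ 2. Both exceed 1/10. -/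
theorem defect_add_tenth_le {a b : ℕ} (hb : 0 < b) (hba : b ≤ a) (hab : 4 ≤ a + b)
    (h : complexity (a + b) = complexity a + complexity b) :
    defect a + 1 / 10 ≤ defect (a + b) := by
  have ha : 0 < a := by omega
  rw [defect_add_eq ha h]
  rcases Nat.lt_or_ge b 2 with hb2 | hb2
  · obtain rfl : b = 1 := by omega
    have h3 : 3 * Real.logb 3 (1 + (1 : ℕ) / a : ℝ) ≤ ((9 : ℕ) : ℝ) / ((10 : ℕ) : ℝ) := by
      refine three_mul_logb_le (by positivity) (by norm_num) ?_
      have : ((1 : ℕ) / a : ℝ) ≤ 1 / 3 := by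
        rw [Nat.cast_one]
        exact one_div_le_one_div_of_le (by norm_num) (by exact_mod_cast (by omega : 3 ≤ a))
      exact (pow_le_pow_left₀ (by positivity)
        (show (1 + (1 : ℕ) / a : ℝ) ≤ 4 / 3 by linarith) _).trans (by norm_num)
    have : (1 : ℝ) ≤ complexity 1 := by exact_mod_cast complexity_pos one_pos
    norm_num at h3 ⊢
    linarith
  · have h3 : 3 * Real.logb 3 (1 + b / a : ℝ) ≤ ((19 : ℕ) : ℝ) / ((10 : ℕ) : ℝ) := by
      refine three_mul_logb_le (by positivity) (by norm_num) ?_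
      have : (b / a : ℝ) ≤ 1 := div_le_one_of_le₀ (by exact_mod_cast hba) (by positivity)
      exact (pow_le_pow_left₀ (by positivity) (show (1 + b / a : ℝ) ≤ 2 by linarith) _).trans
        (by norm_num)
    have : (2 : ℝ) ≤ complexity b := by
      have h2 := pow_three_le_three_pow_complexity hb
      have : 2 ≤ complexity b := by
        by_contra! hlt
        have h8 : 2 ^ 3 ≤ b ^ 3 := Nat.pow_le_pow_left hb2 3
        have : 3 ^ complexity b ≤ 3 ^ 1 := Nat.pow_le_pow_right (by norm_num) (by omega)
        omega
      exact_mod_cast this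
    norm_num at h3
    linarith

theorem defect_three_pow_mul {n : ℕ} (hn : 0 < n) {e : ℕ}
    (h : complexity (3 ^ e * n) = 3 * e + complexity n) : defect (3 ^ e * n) = defect n := by
  unfold defect
  rw [h, logb_three_pow_mul hn]
  push_cast
  ring

/-- The ways in which a number greater than one is obtained, by an expression with the least
number of ones, from numbers of smaller defect. -/
inductive Decomposition (n : ℕ) : Prop
  | three_pow (e : ℕ) (hn : n = 3 ^ e * 3) (hc : complexity n = 3 * e + 3)
  | three_pow_mul_two (e : ℕ) (hn : n = 3 ^ e * 2) (hc : complexity n = 3 * e + 2)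
  | mul (u v : ℕ) (hu : 1 < u) (hv : 1 < v) (hn : n = u * v)
      (hc : complexity n = complexity u + complexity v)
      (hdu : 1 / 10 ≤ defect u) (hdv : 1 / 10 ≤ defect v)
  | three_pow_mul_add (e a b : ℕ) (ha : 1 < a) (hb : 0 < b) (hn : n = 3 ^ e * (a + b))
      (hc : complexity n = 3 * e + (complexity a + complexity b))
      (hdb : (complexity b : ℝ) ≤ defect n + 2) (hda : defect a + 1 / 10 ≤ defect n)

/-- The gap that makes products tractable: a factor either has defect at least 1/10, so that the
other factor has smaller defect than the product, or is a power of 3. -/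
theorem Decomposition.eq_three_pow_or_le_defect {n : ℕ} (h : Decomposition n) :
    (∃ e, n = 3 ^ e * 3 ∧ complexity n = 3 * e + 3) ∨ 1 / 10 ≤ defect n := by
  cases h with
  | three_pow e hn hc => exact .inl ⟨e, hn, hc⟩
  | three_pow_mul_two e hn hc =>
    right
    have h3 : 3 * Real.logb 3 (2 : ℝ) ≤ ((19 : ℕ) : ℝ) / ((10 : ℕ) : ℝ) :=
      three_mul_logb_le (by positivity) (by norm_num) (by norm_num)
    unfold defect
    rw [hc, hn, logb_three_pow_mul (by norm_num)]
    push_cast at h3 ⊢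
    linarith
  | mul u v hu hv hn hc hdu hdv =>
    right
    subst hn
    rw [defect_mul_eq (by omega) (by omega) hc]
    linarith
  | three_pow_mul_add e a b ha hb hn hc hdb hda =>
    right
    have := defect_nonneg (n := a) (by omega)
    linarith

theorem Decomposition.three_pow_scale {n : ℕ} (h : Decomposition n) (e : ℕ)
    (hs : complexity (3 ^ e * n) = 3 * e + complexity n) : Decomposition (3 ^ e * n) := by
  cases h with
  | three_pow f hn hc => exact .three_pow (e + f) (by rw [hn]; ring) (by rw [hs, hc]; ring)
  | three_pow_mul_two f hn hc =>
    exact .three_pow_mul_two (e + f) (by rw [hn]; ring) (by rw [hs, hc]; ring)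
  | mul u v hu hv hn hc hdu hdv =>
    have h1 := complexity_three_pow_mul_le (n := v) (by omega) e
    have heq : 3 ^ e * n = u * (3 ^ e * v) := by rw [hn]; ring
    have h2 := complexity_mul_le (a := u) (b := 3 ^ e * v) (by omega)
      (Nat.mul_pos (by positivity) (by omega))
    rw [← heq] at h2
    refine .mul u (3 ^ e * v) hu ?_ heq (by omega) hdu ?_
    · exact lt_of_lt_of_le hv (Nat.le_mul_of_pos_left _ (by positivity))
    · rwa [defect_three_pow_mul (by omega) (by omega)]
  | three_pow_mul_add f a b ha hb hn hc hdb hda =>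
    have hd := defect_three_pow_mul (n := n) (by rw [hn]; positivity) hs
    exact .three_pow_mul_add (e + f) a b ha hb (by rw [hn]; ring) (by rw [hs, hc]; ring)
      (by rwa [hd]) (by rwa [hd])

theorem Decomposition.of_add {a b : ℕ} (hb : 0 < b) (hba : b ≤ a)
    (h : complexity (a + b) = complexity a + complexity b) : Decomposition (a + b) := by
  have hd0 := defect_nonneg (n := a + b) (by omega)
  have hb1 := complexity_pos hb
  have ha1 := complexity_pos (n := a) (by omega)
  have hbound := complexity_le_defect_add (by omega) hba h
  -- For 2 = 1 + 1 and 3 = 2 + 1 the larger summand has the larger defect, so these become the base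
  -- shapes.
  rcases Nat.lt_or_ge (a + b) 4 with h4 | h4
  · obtain rfl : b = 1 := by omega
    obtain rfl | rfl : a = 1 ∨ a = 2 := by omega
    · have := complexity_two_le
      rw [show 1 + 1 = 2 from rfl] at h ⊢
      exact .three_pow_mul_two 0 (by norm_num) (by omega)
    · have h3 := complexity_three_le
      have h3' := three_mul_le_complexity one_pos 1
      rw [show 3 ^ 1 * 1 = 3 from rfl] at h3'
      rw [show 2 + 1 = 3 from rfl] at h ⊢
      exact .three_pow 0 (by norm_num) (by omega)
  · exact .three_pow_mul_add 0 a b (by omega) hb (by ring) (by omega) hbound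
      (defect_add_tenth_le hb hba h4 h)

theorem decomposition {n : ℕ} (hn : 1 < n) : Decomposition n := by
  induction n using Nat.strong_induction_on with
  | _ n ih =>
  obtain ⟨E, hE, hc⟩ := exists_oneExpr_complexity (n := n) (by omega)
  cases E with
  | one => simp only [OneExpr.val] at hE; omega
  | add A B =>
    simp only [OneExpr.val] at hE
    simp only [OneExpr.ones] at hc
    have hA := A.complexity_val_le
    have hB := B.complexity_val_le
    have hs := complexity_add_le A.val_pos B.val_pos
    subst hE
    rcases le_total B.val A.val with h | h
    · exact .of_add B.val_pos h (by omega)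
    · have := Decomposition.of_add A.val_pos h (by rw [add_comm B.val]; omega)
      rwa [add_comm] at this
  | mul A B =>
    simp only [OneExpr.val] at hE
    simp only [OneExpr.ones] at hc
    have hA := A.complexity_val_le
    have hB := B.complexity_val_le
    have hs := complexity_mul_le A.val_pos B.val_pos
    have hA0 := A.val_pos
    have hB0 := B.val_pos
    have hA1 := complexity_pos hA0
    have hB1 := complexity_pos hB0
    generalize A.val = u at *
    generalize B.val = v at *
    subst hE
    have hcm : complexity (u * v) = complexity u + complexity v := by omega
    have hu : 1 < u := by
      by_contra! h
      obtain rfl : u = 1 := by omega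
      rw [one_mul] at hcm
      omega
    have hv : 1 < v := by
      by_contra! h
      obtain rfl : v = 1 := by omega
      rw [mul_one] at hcm
      omega
    have du := ih u (by nlinarith) hu
    have dv := ih v (by nlinarith) hv
    -- A factor that is a power of 3 leaves the defect unchanged; it is absorbed into the
    -- decomposition of the other factor.
    rcases du.eq_three_pow_or_le_defect with ⟨e, he, hce⟩ | hdu
    · have h := dv.three_pow_scale (e + 1)
        (by rw [pow_succ, ← he, hcm, hce]; ring)
      rwa [pow_succ, ← he] at h
    rcases dv.eq_three_pow_or_le_defect with ⟨e, he, hce⟩ | hdv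
    · rw [mul_comm] at hcm ⊢
      have h := du.three_pow_scale (e + 1)
        (by rw [pow_succ, ← he, hcm, hce]; ring)
      rwa [pow_succ, ← he] at h
    exact .mul u v hu hv rfl hcm hdu hdv

/-! ### Limits of numbers of bounded defect along ultrafilters -/

variable {ι : Type*}

theorem eventually_eq_of_eventually_le {F : Ultrafilter ι} {f : ι → ℕ} {M : ℕ}
    (h : ∀ᶠ i in F, f i ≤ M) : ∃ c, ∀ᶠ i in F, f i = c := by
  have h' : ∀ᶠ i in F, ∃ c ∈ Set.Iic M, f i = c := h.mono fun i hi => ⟨f i, hi, rfl⟩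
  obtain ⟨c, -, hc⟩ := (Ultrafilter.eventually_exists_mem_iff (Set.finite_Iic M)).1 h'
  exact ⟨c, hc⟩

theorem tendsto_atTop_or_eventually_eq (F : Ultrafilter ι) (f : ι → ℕ) :
    Tendsto f F atTop ∨ ∃ c, ∀ᶠ i in F, f i = c := by
  by_cases h : Tendsto f F atTop
  · exact .inl h
  right
  rw [tendsto_atTop] at h
  rw [not_forall] at h
  obtain ⟨M, hM⟩ := h
  exact eventually_eq_of_eventually_le (M := M)
    ((Ultrafilter.eventually_not.2 hM).mono fun i hi => (not_le.1 hi).le)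

/-- Along the ultrafilter `F`, the numbers `n i` with cost `k i` either are `m` times a power of
three, with matching cost at least `‖m‖`, or are asymptotic to such numbers, in which case the cost
is larger by at least one. -/
def HasLimit (F : Ultrafilter ι) (n k : ι → ℕ) (m c : ℕ) : Prop :=
  0 < m ∧ ∃ e : ι → ℕ, (∀ᶠ i in F, k i = 3 * e i + c) ∧
    (((∀ᶠ i in F, n i = 3 ^ e i * m) ∧ complexity m ≤ c) ∨
      (Tendsto e F atTop ∧ Tendsto (fun i => (n i : ℝ) / 3 ^ e i) F (𝓝 m) ∧
        complexity m + 1 ≤ c))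

theorem HasLimit.congr {F : Ultrafilter ι} {n k n' k' : ι → ℕ} {m c : ℕ}
    (h : HasLimit F n k m c) (hn : ∀ᶠ i in F, n' i = n i) (hk : ∀ᶠ i in F, k' i = k i) :
    HasLimit F n' k' m c := by
  obtain ⟨hm, e, he, h⟩ := h
  refine ⟨hm, e, ?_, ?_⟩
  · filter_upwards [he, hk] with i h1 h2
    rw [h2, h1]
  rcases h with ⟨h1, h2⟩ | ⟨h1, h2, h3⟩
  · refine .inl ⟨?_, h2⟩
    filter_upwards [h1, hn] with i h1 h2
    rw [h2, h1]
  · refine .inr ⟨h1, h2.congr' ?_, h3⟩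
    filter_upwards [hn] with i hi
    rw [hi]

theorem HasLimit.exists_tendsto {F : Ultrafilter ι} {n k : ι → ℕ} {m c : ℕ}
    (h : HasLimit F n k m c) :
    0 < m ∧ complexity m ≤ c ∧ ∃ e : ι → ℕ, (∀ᶠ i in F, k i = 3 * e i + c) ∧
      Tendsto (fun i => (n i : ℝ) / 3 ^ e i) F (𝓝 m) ∧
      ((∀ᶠ i in F, n i = 3 ^ e i * m) ∨ Tendsto e F atTop ∧ complexity m + 1 ≤ c) := by
  obtain ⟨hm, e, he, ⟨h1, h2⟩ | ⟨h1, h2, h3⟩⟩ := h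
  · refine ⟨hm, h2, e, he, ?_, .inl h1⟩
    refine tendsto_const_nhds.congr' ?_
    filter_upwards [h1] with i hi
    rw [hi]
    push_cast
    field_simp
  · exact ⟨hm, by omega, e, he, h2, .inr ⟨h1, h3⟩⟩

theorem HasLimit.mul {F : Ultrafilter ι} {n k n' k' : ι → ℕ} {m c m' c' : ℕ}
    (h : HasLimit F n k m c) (h' : HasLimit F n' k' m' c') :
    HasLimit F (fun i => n i * n' i) (fun i => k i + k' i) (m * m') (c + c') := by
  obtain ⟨hm, hc, e, he, ht, hor⟩ := h.exists_tendsto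
  obtain ⟨hm', hc', e', he', ht', hor'⟩ := h'.exists_tendsto
  have hmul := complexity_mul_le hm hm'
  have htm : Tendsto (fun i => ((n i * n' i : ℕ) : ℝ) / 3 ^ (e i + e' i)) F (𝓝 (m * m' : ℕ)) := by
    have := ht.mul ht'
    push_cast
    refine this.congr fun i => ?_
    rw [pow_add]
    field_simp
  refine ⟨by positivity, fun i => e i + e' i, ?_, ?_⟩
  · filter_upwards [he, he'] with i h1 h2
    rw [h1, h2]; ring
  rcases hor with h1 | ⟨h1, h2⟩
  · rcases hor' with h1' | ⟨h1', h2'⟩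
    · refine .inl ⟨?_, by omega⟩
      filter_upwards [h1, h1'] with i h1 h2
      rw [h1, h2]; ring
    · exact .inr ⟨tendsto_atTop_mono (fun i => Nat.le_add_left _ _) h1', htm, by omega⟩
  · exact .inr ⟨tendsto_atTop_mono (fun i => Nat.le_add_right _ _) h1, htm, by omega⟩

theorem HasLimit.three_pow_mul {F : Ultrafilter ι} {n k : ι → ℕ} {m c : ℕ}
    (h : HasLimit F n k m c) (f : ι → ℕ) :
    HasLimit F (fun i => 3 ^ f i * n i) (fun i => 3 * f i + k i) m c := by
  obtain ⟨hm, e, he, hor⟩ := h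
  refine ⟨hm, fun i => f i + e i, ?_, ?_⟩
  · filter_upwards [he] with i h1
    rw [h1]; ring
  rcases hor with ⟨h1, h2⟩ | ⟨h1, h2, h3⟩
  · refine .inl ⟨?_, h2⟩
    filter_upwards [h1] with i h1
    rw [h1]; ring
  · refine .inr ⟨tendsto_atTop_mono (fun i => Nat.le_add_left _ _) h1, h2.congr fun i => ?_, h3⟩
    push_cast
    rw [pow_add]
    field_simp

theorem HasLimit.const (F : Ultrafilter ι) {n k : ℕ} (hn : 0 < n) (hk : complexity n ≤ k) :
    HasLimit F (fun _ => n) (fun _ => k) n k :=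
  ⟨hn, fun _ => 0, by simp, .inl ⟨by simp, hk⟩⟩

/-- If the exponents tend to infinity, b vanishes in the limit but its cost, at least 1, remains.
Otherwise the exponents, and hence the numbers, are eventually constant and the sum is a constant.
-/
theorem HasLimit.add {F : Ultrafilter ι} {n k : ι → ℕ} {m c b : ℕ}
    (h : HasLimit F n k m c) (hb : 0 < b) (hn : ∀ᶠ i in F, complexity (n i) ≤ k i)
    (hn0 : ∀ᶠ i in F, 0 < n i) :
    ∃ m' c', HasLimit F (fun i => n i + b) (fun i => k i + complexity b) m' c' := by
  obtain ⟨hm, hc, e, he, ht, hor⟩ := h.exists_tendsto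
  have hb1 := complexity_pos hb
  rcases tendsto_atTop_or_eventually_eq F e with htop | ⟨e₀, he₀⟩
  · refine ⟨m, c + complexity b, hm, e, ?_, .inr ⟨htop, ?_, by omega⟩⟩
    · filter_upwards [he] with i h1
      rw [h1]; ring
    · have h0 : Tendsto (fun i => (b : ℝ) / 3 ^ e i) F (𝓝 0) :=
        ((tendsto_pow_atTop_atTop_of_one_lt (by norm_num : (1 : ℝ) < 3)).comp htop).const_div_atTop _
      have := ht.add h0
      rw [add_zero] at this
      refine this.congr fun i => ?_
      push_cast
      ring
  · obtain ⟨N, hN⟩ : ∃ N, ∀ᶠ i in F, n i = N := by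
      obtain ⟨M, hM⟩ := exists_nat_gt ((m + 1 : ℝ) * 3 ^ e₀)
      refine eventually_eq_of_eventually_le (M := M) ?_
      filter_upwards [he₀, ht.eventually_lt_const (lt_add_one (m : ℝ))] with i h1 h2
      rw [h1, div_lt_iff₀ (by positivity)] at h2
      exact_mod_cast (h2.trans hM).le
    have hk : ∀ᶠ i in F, k i = 3 * e₀ + c := by
      filter_upwards [he, he₀] with i h1 h2
      rw [h1, h2]
    obtain ⟨i, h1, h2, h3, h4⟩ := (hN.and (hk.and (hn.and hn0))).exists
    rw [h1, h2] at h3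
    rw [h1] at h4
    refine ⟨N + b, 3 * e₀ + c + complexity b, (HasLimit.const F (by omega) ?_).congr ?_ ?_⟩
    · exact (complexity_add_le h4 hb).trans (by omega)
    · filter_upwards [hN] with i hi
      rw [hi]
    · filter_upwards [hk] with i hi
      rw [hi]

/-- An ultrafilter selects a single shape of `Decomposition`, whose parts of smaller defect have
limits by induction; the bounded summand is eventually constant. -/
theorem exists_hasLimit_of_defect_le (F : Ultrafilter ι) (N : ℕ) (n : ι → ℕ)
    (hn : ∀ᶠ i in F, 1 < n i) (hd : ∀ᶠ i in F, defect (n i) ≤ N / 10) :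
    ∃ m c, HasLimit F n (fun i => complexity (n i)) m c := by
  induction N generalizing n with
  | zero =>
    have h : ∀ᶠ i in F, ∃ e, n i = 3 ^ e * 3 ∧ complexity (n i) = 3 * e + 3 := by
      filter_upwards [hn, hd] with i h1 h2
      refine (decomposition h1).eq_three_pow_or_le_defect.resolve_right fun h3 => ?_
      norm_num at h2 h3
      linarith
    obtain ⟨e, he⟩ := h.choice
    exact ⟨3, 3, ((HasLimit.const F (by norm_num) complexity_three_le).three_pow_mul e).congr
      (he.mono fun i hi => hi.1) (he.mono fun i hi => hi.2)⟩
  | succ N ih =>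
    have h : ∀ᶠ i in F, (∃ e, n i = 3 ^ e * 3 ∧ complexity (n i) = 3 * e + 3) ∨
        (∃ e, n i = 3 ^ e * 2 ∧ complexity (n i) = 3 * e + 2) ∨
        (∃ p : ℕ × ℕ, 1 < p.1 ∧ 1 < p.2 ∧ n i = p.1 * p.2 ∧
          complexity (n i) = complexity p.1 + complexity p.2 ∧
          defect p.1 ≤ N / 10 ∧ defect p.2 ≤ N / 10) ∨
        (∃ p : ℕ × ℕ × ℕ, 1 < p.2.1 ∧ 0 < p.2.2 ∧ n i = 3 ^ p.1 * (p.2.1 + p.2.2) ∧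
          complexity (n i) = 3 * p.1 + (complexity p.2.1 + complexity p.2.2) ∧
          p.2.2 ≤ 3 ^ (N + 3) ∧ defect p.2.1 ≤ N / 10) := by
      filter_upwards [hn, hd] with i h1 h2
      push_cast at h2
      cases decomposition h1 with
      | three_pow e hn hc => exact .inl ⟨e, hn, hc⟩
      | three_pow_mul_two e hn hc => exact .inr (.inl ⟨e, hn, hc⟩)
      | mul u v hu hv hn hc hdu hdv =>
        rw [hn] at h2 hc
        rw [defect_mul_eq (by omega) (by omega) hc] at h2
        exact .inr (.inr (.inl ⟨(u, v), hu, hv, hn, hn ▸ hc, by linarith, by linarith⟩))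
      | three_pow_mul_add e a b ha hb hn hc hdb hda =>
        refine .inr (.inr (.inr ⟨(e, a, b), ha, hb, hn, hc, ?_, by linarith⟩))
        have h3 : (complexity b : ℝ) ≤ (N + 3 : ℕ) := by
          push_cast
          have : (0 : ℝ) ≤ N := by positivity
          linarith
        have h4 : complexity b ≤ N + 3 := by exact_mod_cast h3
        calc b ≤ b ^ 3 := Nat.le_self_pow (by norm_num) b
          _ ≤ 3 ^ complexity b := pow_three_le_three_pow_complexity hb
          _ ≤ 3 ^ (N + 3) := Nat.pow_le_pow_right (by norm_num) h4
    rcases Ultrafilter.eventually_or.1 h with h | h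
    · obtain ⟨e, he⟩ := h.choice
      exact ⟨3, 3, ((HasLimit.const F (by norm_num) complexity_three_le).three_pow_mul e).congr
        (he.mono fun i hi => hi.1) (he.mono fun i hi => hi.2)⟩
    rcases Ultrafilter.eventually_or.1 h with h | h
    · obtain ⟨e, he⟩ := h.choice
      exact ⟨2, 2, ((HasLimit.const F (by norm_num) complexity_two_le).three_pow_mul e).congr
        (he.mono fun i hi => hi.1) (he.mono fun i hi => hi.2)⟩
    rcases Ultrafilter.eventually_or.1 h with h | h
    · obtain ⟨p, hp⟩ := h.choice
      obtain ⟨m, c, h1⟩ := ih (fun i => (p i).1) (hp.mono fun i hi => hi.1)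
        (hp.mono fun i hi => hi.2.2.2.2.1)
      obtain ⟨m', c', h2⟩ := ih (fun i => (p i).2) (hp.mono fun i hi => hi.2.1)
        (hp.mono fun i hi => hi.2.2.2.2.2)
      exact ⟨_, _, (h1.mul h2).congr (hp.mono fun i hi => hi.2.2.1)
        (hp.mono fun i hi => hi.2.2.2.1)⟩
    · obtain ⟨p, hp⟩ := h.choice
      obtain ⟨b, hb⟩ := eventually_eq_of_eventually_le (f := fun i => (p i).2.2)
        (hp.mono fun i hi => hi.2.2.2.2.1)
      have hb0 : 0 < b := by
        obtain ⟨i, h1, h2⟩ := (hp.and hb).exists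
        exact h2 ▸ h1.2.1
      obtain ⟨m, c, h1⟩ := ih (fun i => (p i).2.1) (hp.mono fun i hi => hi.1)
        (hp.mono fun i hi => hi.2.2.2.2.2)
      obtain ⟨m', c', h2⟩ := h1.add hb0 (.of_forall fun i => le_rfl)
        (hp.mono fun i hi => by have := hi.1; omega)
      refine ⟨m', c', (h2.three_pow_mul fun i => (p i).1).congr ?_ ?_⟩
      · filter_upwards [hp, hb] with i h1 h2
        rw [h1.2.2.1, h2]
      · filter_upwards [hp, hb] with i h1 h2
        rw [h1.2.2.2.1, h2]

/-! ### Uniqueness of limits up to powers of 3, and stability of 3^a m + 1 -/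

theorem eventually_eq_add_of_tendsto_div_pow {F : Ultrafilter ι} {x : ι → ℝ} {e p : ι → ℕ}
    {m m' : ℕ} (hm : 0 < m) (hx : ∀ᶠ i in F, 0 < x i)
    (he : Tendsto (fun i => x i / 3 ^ e i) F (𝓝 m'))
    (hp : Tendsto (fun i => x i / 3 ^ p i) F (𝓝 m)) (h : ∀ᶠ i in F, e i ≤ p i) :
    ∃ d, (∀ᶠ i in F, p i = e i + d) ∧ m' = 3 ^ d * m := by
  have hm' : (m : ℝ) ≠ 0 := by positivity
  -- The quotient of the two normalizations is a convergent sequence of integral powers of 3, so its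
  -- exponent is bounded and eventually constant.
  have hq : Tendsto (fun i => (3 : ℝ) ^ (p i - e i)) F (𝓝 (m' / m)) := by
    refine (he.div hp hm').congr' ?_
    filter_upwards [hx, h] with i h1 h2
    rw [pow_sub₀ _ (by norm_num) h2]
    simp only [Pi.div_apply]
    field_simp
  obtain ⟨M, hM⟩ := exists_nat_gt ((m' / m : ℝ))
  obtain ⟨d, hd⟩ : ∃ d, ∀ᶠ i in F, p i - e i = d := by
    refine eventually_eq_of_eventually_le (M := M) ?_
    filter_upwards [hq.eventually_lt_const hM] with i hi
    have h1 : 3 ^ (p i - e i) < M := by exact_mod_cast hi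
    exact ((Nat.lt_pow_self (by norm_num)).trans h1).le
  refine ⟨d, ?_, ?_⟩
  · filter_upwards [hd, h] with i h1 h2
    omega
  · have hq' : Tendsto (fun i => (3 : ℝ) ^ (p i - e i)) F (𝓝 (3 ^ d)) := by
      refine tendsto_const_nhds.congr' ?_
      filter_upwards [hd] with i hi
      rw [hi]
    have := tendsto_nhds_unique hq hq'
    rw [div_eq_iff hm'] at this
    exact_mod_cast this

/-- Among numbers equal up to powers of 3, a stable one has the least cost once these powers are
charged 3 per factor. -/
theorem IsStable.le_of_three_pow_mul_eq {m m' s t : ℕ} (hm : IsStable m) (hm' : 0 < m')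
    (h : 3 ^ s * m = 3 ^ t * m') : 3 * s + complexity m ≤ 3 * t + complexity m' := by
  rw [← hm.2 s, h]
  exact complexity_three_pow_mul_le hm' t

theorem tendsto_three_pow_mul_add_one (m : ℕ) :
    Tendsto (fun a : ℕ => ((3 ^ a * m + 1 : ℕ) : ℝ) / 3 ^ a) atTop (𝓝 m) := by
  have h0 : Tendsto (fun a : ℕ => (1 : ℝ) / 3 ^ a) atTop (𝓝 0) :=
    (tendsto_pow_atTop_atTop_of_one_lt (by norm_num : (1 : ℝ) < 3)).const_div_atTop _
  have := (tendsto_const_nhds (x := (m : ℝ))).add h0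
  rw [add_zero] at this
  refine this.congr fun a => ?_
  push_cast
  field_simp

/-- If `m` is stable then `3 ^ a * m + 1` has no expression better than the obvious one, even after
multiplication by a power of three, for all large `a`. -/
theorem IsStable.eventually_le_complexity {m : ℕ} (hm : IsStable m) :
    ∀ᶠ a in atTop, ∀ t,
      3 * (t + a) + complexity m + 1 ≤ complexity (3 ^ t * (3 ^ a * m + 1)) := by
  by_contra hcon
  have hne : (atTop ⊓ 𝓟 {a | ¬ ∀ t, 3 * (t + a) + complexity m + 1 ≤
      complexity (3 ^ t * (3 ^ a * m + 1))}).NeBot := 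
    frequently_mem_iff_neBot.1 (not_eventually.1 hcon)
  let F := Ultrafilter.of (atTop ⊓ 𝓟 {a | ¬ ∀ t, 3 * (t + a) + complexity m + 1 ≤
      complexity (3 ^ t * (3 ^ a * m + 1))})
  have hF : (F : Filter ℕ) ≤ _ := Ultrafilter.of_le _
  have hFtop : (F : Filter ℕ) ≤ atTop := hF.trans inf_le_left
  have hFev : ∀ᶠ a in F, ∃ t, complexity (3 ^ t * (3 ^ a * m + 1)) ≤ 3 * (t + a) + complexity m := by
    have : ∀ᶠ a in F, ¬ ∀ t, 3 * (t + a) + complexity m + 1 ≤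
      complexity (3 ^ t * (3 ^ a * m + 1)) := hF (mem_inf_of_right (mem_principal_self _))
    filter_upwards [this] with a ha
    rw [not_forall] at ha
    obtain ⟨t, ht⟩ := ha
    exact ⟨t, by omega⟩
  obtain ⟨t, ht⟩ := hFev.choice
  have hm0 := hm.1
  have hn : ∀ a, 1 < 3 ^ t a * (3 ^ a * m + 1) := fun a => by
    have h1 : 0 < 3 ^ a * m := by positivity
    have h2 : 0 < 3 ^ t a := by positivity
    nlinarith
  -- A counterexample costs at most 3 (t + a) + ‖m‖ and exceeds 3^(t + a) m, so its defect is at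
  -- most δ(m).
  obtain ⟨N, hN⟩ := exists_nat_gt (10 * defect m)
  obtain ⟨m', c, hlim⟩ := exists_hasLimit_of_defect_le F N
    (fun a => 3 ^ t a * (3 ^ a * m + 1)) (.of_forall hn) (by
      filter_upwards [ht] with a ha
      have h1 : (complexity (3 ^ t a * (3 ^ a * m + 1)) : ℝ) ≤
          3 * ((t a + a : ℕ) : ℝ) + complexity m := by exact_mod_cast ha
      have h2 : Real.logb 3 ((3 ^ (t a + a) * m : ℕ) : ℝ) ≤
          Real.logb 3 ((3 ^ t a * (3 ^ a * m + 1) : ℕ) : ℝ) := by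
        refine Real.logb_le_logb_of_le (by norm_num) (by positivity) ?_
        have : 3 ^ (t a + a) * m ≤ 3 ^ t a * (3 ^ a * m + 1) := by
          rw [pow_add, mul_assoc]
          exact Nat.mul_le_mul_left _ (Nat.le_succ _)
        exact_mod_cast this
      rw [logb_three_pow_mul hm0] at h2
      unfold defect at hN ⊢
      linarith)
  obtain ⟨hm', hc, e, he, htend, hor⟩ := hlim.exists_tendsto
  have htm : Tendsto (fun a => ((3 ^ t a * (3 ^ a * m + 1) : ℕ) : ℝ) / 3 ^ (t a + a)) F
      (𝓝 m) := by
    refine ((tendsto_three_pow_mul_add_one m).mono_left hFtop).congr fun a => ?_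
    push_cast
    rw [pow_add]
    field_simp
  have hpos : ∀ᶠ a in F, (0 : ℝ) < ((3 ^ t a * (3 ^ a * m + 1) : ℕ) : ℝ) :=
    .of_forall fun a => by have := hn a; exact_mod_cast (by omega : 0 < 3 ^ t a * (3 ^ a * m + 1))
  -- The sequence is also asymptotic to 3^(t + a) m, so m and m' agree up to powers of 3.
  obtain ⟨s, r, hsr, hrel⟩ : ∃ s r, 3 ^ s * m = 3 ^ r * m' ∧ ∀ᶠ a in F, e a + s = t a + a + r := by
    rcases Ultrafilter.eventually_or.1
      (Eventually.of_forall (f := (F : Filter ℕ)) fun a => le_total (e a) (t a + a)) with h | h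
    · obtain ⟨d, h1, h2⟩ := eventually_eq_add_of_tendsto_div_pow hm0 hpos htend htm h
      exact ⟨d, 0, by omega, h1.mono fun a ha => by omega⟩
    · obtain ⟨d, h1, h2⟩ := eventually_eq_add_of_tendsto_div_pow hm' hpos htm htend h
      exact ⟨0, d, by omega, h1.mono fun a ha => by omega⟩
  have hle := hm.le_of_three_pow_mul_eq hm' hsr
  -- An exact limit would force 3^a m + 1 = 3^a m; an asymptotic one costs 1 more than stability of
  -- m and the assumed bound allow.
  rcases hor with h | ⟨-, h⟩
  · obtain ⟨a, h1, h2⟩ := (h.and hrel).exists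
    have h3 : 3 ^ s * (3 ^ t a * (3 ^ a * m + 1)) = 3 ^ s * (3 ^ t a * (3 ^ a * m)) := by
      calc 3 ^ s * (3 ^ t a * (3 ^ a * m + 1)) = 3 ^ (e a + s) * m' := by rw [h1]; ring
        _ = 3 ^ (t a + a) * (3 ^ r * m') := by rw [h2]; ring
        _ = _ := by rw [← hsr]; ring
    have h4 := Nat.eq_of_mul_eq_mul_left (by positivity) (Nat.eq_of_mul_eq_mul_left (by positivity) h3)
    omega
  · obtain ⟨a, h1, h2, h3⟩ := (he.and (hrel.and ht)).exists
    omega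

theorem IsStable.eventually_isStable {m : ℕ} (hm : IsStable m) :
    ∀ᶠ a in atTop, IsStable (3 ^ a * m + 1) ∧
      complexity (3 ^ a * m + 1) = 3 * a + complexity m + 1 := by
  filter_upwards [hm.eventually_le_complexity] with a ha
  have hm0 := hm.1
  have h1 := ha 0
  have h2 := complexity_add_le (a := 3 ^ a * m) (b := 1) (by positivity) one_pos
  have h3 := complexity_three_pow_mul_le hm0 a
  have h4 := complexity_one_le
  rw [pow_zero, one_mul] at h1
  refine ⟨.of_le (by omega) fun k => ?_, by omega⟩
  have h5 := ha k
  omega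

/-! ### The sets of stable defects -/

/-- Exponentiating gives n^3 3^c' = n'^3 3^c, so n and n' have the same part prime to 3; the
exponents come from the 3-adic valuations. -/
theorem exists_three_pow_mul_eq_of_sub_logb_eq {n n' c c' : ℕ} (hn : 0 < n) (hn' : 0 < n')
    (h : (c : ℝ) - 3 * Real.logb 3 n = c' - 3 * Real.logb 3 n') :
    ∃ s t, 3 ^ s * n = 3 ^ t * n' ∧ c + 3 * s = c' + 3 * t := by
  have hpow : n ^ 3 * 3 ^ c' = n' ^ 3 * 3 ^ c := by
    have h1 : Real.logb 3 ((n : ℝ) ^ 3 * 3 ^ c') = Real.logb 3 ((n' : ℝ) ^ 3 * 3 ^ c) := by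
      rw [Real.logb_mul (by positivity) (by positivity),
        Real.logb_mul (by positivity) (by positivity)]
      simp only [Real.logb_pow, Real.logb_self_eq_one (by norm_num : (1 : ℝ) < 3)]
      push_cast
      linarith
    have h2 := Real.logb_injOn_pos (by norm_num : (1 : ℝ) < 3)
      (Set.mem_Ioi.2 (by positivity)) (Set.mem_Ioi.2 (by positivity)) h1
    exact_mod_cast h2
  have hfac : 3 * n.factorization 3 + c' = 3 * n'.factorization 3 + c := by
    have := congrArg (fun x => x.factorization 3) hpow
    simpa [Nat.factorization_mul, hn.ne', hn'.ne', Nat.prime_three.factorization] using this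
  refine ⟨n'.factorization 3, n.factorization 3, ?_, by omega⟩
  generalize n.factorization 3 = t at *
  generalize n'.factorization 3 = s at *
  refine Nat.pow_left_injective (n := 3) (by norm_num) ?_
  refine Nat.eq_of_mul_eq_mul_right (show 0 < 3 ^ c' by positivity) ?_
  simp only
  calc (3 ^ s * n) ^ 3 * 3 ^ c' = 3 ^ (3 * s) * (n ^ 3 * 3 ^ c') := by ring
    _ = n' ^ 3 * 3 ^ (3 * s + c) := by rw [hpow]; ring
    _ = (3 ^ t * n') ^ 3 * 3 ^ c' := by rw [← hfac]; ring

theorem natCast_eq_of_add_three_mul_eq {a b s t : ℕ} (h : a + 3 * s = b + 3 * t) :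
    (a : ZMod 3) = b := by
  have h3 : (3 : ZMod 3) = 0 := by decide
  have := congrArg (Nat.cast (R := ZMod 3)) h
  push_cast at this
  simpa [h3] using this

/-- The witness for the residue and the stable witness may differ, but equal defects force
complexities congruent mod 3. -/
theorem mem_stableDefectSetMod {u : ZMod 3} {x : ℝ} :
    x ∈ stableDefectSetMod u ↔ ∃ n, IsStable n ∧ (complexity n : ZMod 3) = u ∧ defect n = x := by
  constructor
  · rintro ⟨⟨n, hn, hu, rfl⟩, m, hm, hmn⟩
    refine ⟨m, hm, ?_, hmn⟩
    obtain ⟨s, t, -, h⟩ := exists_three_pow_mul_eq_of_sub_logb_eq hm.1 (by omega) hmn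
    rw [← hu]
    exact natCast_eq_of_add_three_mul_eq h
  · rintro ⟨n, hn, hu, rfl⟩
    exact ⟨⟨n, hn.one_lt, hu, rfl⟩, n, hn, rfl⟩

/-- The set of values `k - 3 log₃ n` with `k ≥ ‖n‖` and `k ≡ u (mod 3)`. -/
def upperDefectSetMod (u : ZMod 3) : Set ℝ :=
  {x : ℝ | ∃ k n : ℕ, 0 < n ∧ complexity n ≤ k ∧ (k : ZMod 3) = u ∧
    x = (k : ℝ) - 3 * Real.logb 3 (n : ℝ)}

theorem mem_upperDefectSetMod {u : ZMod 3} {x : ℝ} :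
    x ∈ upperDefectSetMod u ↔
      ∃ n j : ℕ, IsStable n ∧ (complexity n : ZMod 3) = u - j ∧ x = defect n + j := by
  constructor
  · rintro ⟨k, n, hn, hk, rfl, rfl⟩
    -- Replacing (k, n) by (k + 3K, 3^K n) keeps the value and the residue; `j` is the remaining
    -- excess over the complexity.
    obtain ⟨K, hK⟩ := exists_isStable_three_pow_mul hn
    have h := complexity_three_pow_mul_le hn K
    obtain ⟨j, hj⟩ : ∃ j, k + 3 * K = complexity (3 ^ K * n) + j :=
      ⟨k + 3 * K - complexity (3 ^ K * n), by omega⟩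
    refine ⟨3 ^ K * n, j, hK, ?_, ?_⟩
    · rw [eq_sub_iff_add_eq, ← Nat.cast_add]
      exact natCast_eq_of_add_three_mul_eq (s := 0) (t := K) (by omega)
    · have hj' : (k : ℝ) + 3 * K = complexity (3 ^ K * n) + j := by exact_mod_cast hj
      rw [defect, logb_three_pow_mul hn]
      linarith
  · rintro ⟨n, j, hn, hu, rfl⟩
    refine ⟨complexity n + j, n, hn.1, Nat.le_add_right _ _, ?_, ?_⟩
    · rw [Nat.cast_add, hu, sub_add_cancel]
    · rw [defect]
      push_cast
      ring

theorem tendsto_sub_logb_of_hasLimit {F : Ultrafilter ι} {n k : ι → ℕ} {m c : ℕ}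
    (h : HasLimit F n k m c) (hn : ∀ᶠ i in F, 0 < n i) :
    Tendsto (fun i => (k i : ℝ) - 3 * Real.logb 3 (n i)) F (𝓝 (c - 3 * Real.logb 3 m)) := by
  obtain ⟨hm, -, e, he, ht, -⟩ := h.exists_tendsto
  have hlog : Tendsto (fun i => Real.logb 3 ((n i : ℝ) / 3 ^ e i)) F (𝓝 (Real.logb 3 m)) :=
    (Real.continuousAt_log (by positivity)).tendsto.comp ht |>.div_const _
  refine ((tendsto_const_nhds (x := (c : ℝ))).sub (hlog.const_mul 3)).congr' ?_
  filter_upwards [he, hn] with i h1 h2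
  rw [h1, Real.logb_div (by positivity) (by positivity), Real.logb_pow,
    Real.logb_self_eq_one (by norm_num)]
  push_cast
  ring

/-- A limit of stable defects along an ultrafilter is either `k - 3 log₃ m` for some `k > ‖m‖`, or
is eventually attained. -/
theorem exists_of_ultrafilter_le_nhds {u : ZMod 3} {x : ℝ} {F : Ultrafilter ℝ}
    (hF : ∀ᶠ y in F, y ∈ stableDefectSetMod u) (hx : (F : Filter ℝ) ≤ 𝓝 x) :
    ∃ m c : ℕ, 0 < m ∧ (c : ZMod 3) = u ∧ x = c - 3 * Real.logb 3 m ∧ complexity m ≤ c ∧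
      (complexity m + 1 ≤ c ∨ ∀ᶠ y in F, y = x) := by
  have hF' : ∀ᶠ y in F, ∃ n, IsStable n ∧ (complexity n : ZMod 3) = u ∧ defect n = y :=
    hF.mono fun y hy => mem_stableDefectSetMod.1 hy
  obtain ⟨n, hn⟩ := hF'.choice
  obtain ⟨N, hN⟩ := exists_nat_gt (10 * (x + 1))
  obtain ⟨m, c, hlim⟩ := exists_hasLimit_of_defect_le F N n (hn.mono fun y hy => hy.1.one_lt) (by
    have : ∀ᶠ y in F, y < x + 1 := hx (Iio_mem_nhds (lt_add_one x))
    filter_upwards [hn, this] with y h1 h2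
    rw [h1.2.2]
    linarith)
  have hdef := tendsto_sub_logb_of_hasLimit hlim (hn.mono fun y hy => hy.1.1)
  have hid : Tendsto (fun y => (complexity (n y) : ℝ) - 3 * Real.logb 3 (n y)) F (𝓝 x) := by
    have : Tendsto (fun y : ℝ => y) F (𝓝 x) := hx
    exact this.congr' (hn.mono fun y hy => hy.2.2.symm)
  have hxe := tendsto_nhds_unique hid hdef
  obtain ⟨hm, e, he, hor⟩ := hlim
  obtain ⟨y, h1, h2⟩ := (hn.and he).exists
  simp only at h2
  refine ⟨m, c, hm, ?_, hxe, by omega, ?_⟩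
  · rw [← h1.2.1]
    exact natCast_eq_of_add_three_mul_eq (s := e y) (t := 0) (by omega)
  rcases hor with ⟨h, -⟩ | ⟨-, -, h⟩
  · right
    filter_upwards [hn, he, h] with y h1 h2 h3
    rw [← h1.2.2, hxe, defect, h2, h3, logb_three_pow_mul hm]
    push_cast
    ring
  · exact .inl h

theorem closure_stableDefectSetMod_subset (u : ZMod 3) :
    closure (stableDefectSetMod u) ⊆ upperDefectSetMod u := by
  intro x hx
  obtain ⟨F, hF, hFx⟩ := mem_closure_iff_ultrafilter.1 hx
  obtain ⟨m, c, hm, hc, hxe, hmc, -⟩ := exists_of_ultrafilter_le_nhds hF hFx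
  exact ⟨c, m, hm, hmc, hc, hxe⟩

/-- Each step trades one unit of `j` for a limit: the defect of 3^a m + 1 tends to δ(m) + 1, while
the complexity rises by 1 mod 3. -/
theorem defect_add_mem_closure (j : ℕ) {u : ZMod 3} {m : ℕ} (hm : IsStable m)
    (hu : (complexity m : ZMod 3) = u - j) : defect m + j ∈ closure (stableDefectSetMod u) := by
  induction j generalizing m with
  | zero =>
    refine subset_closure (mem_stableDefectSetMod.2 ⟨m, hm, ?_, by simp⟩)
    simpa using hu
  | succ j ih =>
    have hm0 := hm.1
    have ht : Tendsto (fun a : ℕ => defect (3 ^ a * m + 1) + j) atTop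
        (𝓝 (defect m + (j + 1 : ℕ))) := by
      have hlog : Tendsto (fun a : ℕ => Real.logb 3 (((3 ^ a * m + 1 : ℕ) : ℝ) / 3 ^ a)) atTop
          (𝓝 (Real.logb 3 m)) :=
        (Real.continuousAt_log (by positivity)).tendsto.comp
          (tendsto_three_pow_mul_add_one m) |>.div_const _
      have h := (tendsto_const_nhds (x := (complexity m : ℝ) + 1 + j)).sub (hlog.const_mul 3)
      rw [show defect m + ((j + 1 : ℕ) : ℝ) = complexity m + 1 + j - 3 * Real.logb 3 m by
        rw [defect]; push_cast; ring]
      refine h.congr' ?_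
      filter_upwards [hm.eventually_isStable] with a ha
      rw [defect, ha.2, Real.logb_div (by positivity) (by positivity), Real.logb_pow,
        Real.logb_self_eq_one (by norm_num)]
      push_cast
      ring
    refine isClosed_closure.mem_of_tendsto ht ?_
    filter_upwards [hm.eventually_isStable] with a ha
    refine ih ha.1 ?_
    have h3 : (3 : ZMod 3) = 0 := by decide
    rw [ha.2]
    push_cast at hu ⊢
    rw [hu, h3]
    ring

theorem closure_stableDefectSetMod (u : ZMod 3) :
    closure (stableDefectSetMod u) = upperDefectSetMod u := by
  refine (closure_stableDefectSetMod_subset u).antisymm fun x hx => ?_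
  obtain ⟨n, j, hn, hu, rfl⟩ := mem_upperDefectSetMod.1 hx
  exact defect_add_mem_closure j hn hu

theorem isDiscrete_stableDefectSetMod (u : ZMod 3) : IsDiscrete (stableDefectSetMod u) := by
  rw [isDiscrete_iff_nhdsNE]
  intro x hx
  by_contra hne
  have : (𝓝[≠] x ⊓ 𝓟 (stableDefectSetMod u)).NeBot := ⟨hne⟩
  obtain ⟨F, hF⟩ := Ultrafilter.exists_le (𝓝[≠] x ⊓ 𝓟 (stableDefectSetMod u))
  have hF1 : ∀ᶠ y in F, y ∈ stableDefectSetMod u := hF (mem_inf_of_right (mem_principal_self _))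
  have hF2 : ∀ᶠ y in F, y ≠ x := hF (mem_inf_of_left self_mem_nhdsWithin)
  obtain ⟨m, c, hm, -, hxe, -, hor⟩ := exists_of_ultrafilter_le_nhds hF1
    (hF.trans (inf_le_left.trans nhdsWithin_le_nhds))
  -- In the first case x = c - 3 log₃ m with c > ‖m‖, although x is a stable defect and so has the
  -- least possible cost.
  rcases hor with h | h
  · obtain ⟨n, hn, -, hnx⟩ := mem_stableDefectSetMod.1 hx
    obtain ⟨s, t, h1, h2⟩ := exists_three_pow_mul_eq_of_sub_logb_eq hn.1 hm (hnx.trans hxe)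
    have := hn.le_of_three_pow_mul_eq hm h1
    omega
  · obtain ⟨y, h1, h2⟩ := (h.and hF2).exists
    exact h2 h1

theorem mem_stableDefectSetMod_add_threeMultiples {u : ZMod 3} {x : ℝ} :
    x ∈ stableDefectSetMod u + threeMultiples ↔
      ∃ n i : ℕ, IsStable n ∧ (complexity n : ZMod 3) = u ∧ x = defect n + 3 * i := by
  simp only [Set.mem_add, threeMultiples, Set.mem_range, mem_stableDefectSetMod]
  constructor
  · rintro ⟨_, ⟨n, hn, hu, rfl⟩, _, ⟨i, rfl⟩, rfl⟩
    exact ⟨n, i, hn, hu, rfl⟩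
  · rintro ⟨n, i, hn, hu, rfl⟩
    exact ⟨_, ⟨n, hn, hu, rfl⟩, _, ⟨i, rfl⟩, rfl⟩

theorem upperDefectSetMod_eq_union (u : ZMod 3) :
    upperDefectSetMod u =
      (stableDefectSetMod u + threeMultiples) ∪
      (stableDefectSetMod (u - 1) + threeMultiples + {(1 : ℝ)}) ∪
      (stableDefectSetMod (u - 2) + threeMultiples + {(2 : ℝ)}) := by
  have h3 : (3 : ZMod 3) = 0 := by decide
  ext x
  simp only [Set.mem_union, Set.add_singleton, Set.mem_image,
    mem_stableDefectSetMod_add_threeMultiples, mem_upperDefectSetMod]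
  constructor
  · rintro ⟨n, j, hn, hu, rfl⟩
    obtain ⟨i, hj⟩ : ∃ i, j = 3 * i ∨ j = 3 * i + 1 ∨ j = 3 * i + 2 := ⟨j / 3, by omega⟩
    rcases hj with rfl | rfl | rfl
    · exact .inl (.inl ⟨n, i, hn, by simp [hu, h3], by push_cast; ring⟩)
    · exact .inl (.inr ⟨_, ⟨n, i, hn, by simp [hu, h3], rfl⟩, by push_cast; ring⟩)
    · exact .inr ⟨_, ⟨n, i, hn, by simp [hu, h3], rfl⟩, by push_cast; ring⟩
  · rintro ((⟨n, i, hn, hu, rfl⟩ | ⟨_, ⟨n, i, hn, hu, rfl⟩, rfl⟩) |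
      ⟨_, ⟨n, i, hn, hu, rfl⟩, rfl⟩)
    · exact ⟨n, 3 * i, hn, by simp [hu, h3], by push_cast; ring⟩
    · exact ⟨n, 3 * i + 1, hn, by simp [hu, h3], by push_cast; ring⟩
    · exact ⟨n, 3 * i + 2, hn, by simp [hu, h3], by push_cast; ring⟩

end IntegerComplexity

theorem mainTheorem10 (u : ZMod 3) :
    closure (IntegerComplexity.stableDefectSetMod u) =
        (IntegerComplexity.stableDefectSetMod u + IntegerComplexity.threeMultiples) ∪
        (IntegerComplexity.stableDefectSetMod (u - 1) + IntegerComplexity.threeMultiples +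
          {(1 : ℝ)}) ∪
        (IntegerComplexity.stableDefectSetMod (u - 2) + IntegerComplexity.threeMultiples +
          {(2 : ℝ)}) ∧
    closure (IntegerComplexity.stableDefectSetMod u) =
        {x : ℝ | ∃ k n : ℕ, 0 < n ∧ IntegerComplexity.complexity n ≤ k ∧ (k : ZMod 3) = u ∧
          x = (k : ℝ) - 3 * Real.logb 3 (n : ℝ)} ∧
    IsDiscrete (IntegerComplexity.stableDefectSetMod u) := by
  rw [← IntegerComplexity.upperDefectSetMod_eq_union]
  exact ⟨IntegerComplexity.closure_stableDefectSetMod u,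
    IntegerComplexity.closure_stableDefectSetMod u,
    IntegerComplexity.isDiscrete_stableDefectSetMod u⟩
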